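/- Let $E$ be a completely regular Hausdorff topological space such that (1) every compact subset of $E$ is metrizable, (2) the Borel $\sigma$-algebra $\mathscr B(E)$ coincides with the Baire $\sigma$-algebra (the one generated by all continuous functions $E\to\mathbb R$), and (3) a function $\varphi\colon E\to\mathbb R$ is continuous as soon as its restriction to every compact set is continuous. Let $\kappa\colon E\to(0,\infty)$ be continuous and bounded, and let $C_\kappa(E)$ be the space of continuous $\varphi\colon E\to\mathbb R$ with $\sup_{x\in E}|\kappa(x)\varphi(x)|<\infty$, endowed with the mixed topology $\tau_\kappa^{\mathscr M}$, i.e. the locally convex topology defined by the seminorms $$p_{\kappa,(C_n),(a_n)}(\varphi)=\sup_{n}\sup_{x\in C_n}a_n\kappa(x)|\varphi(x)|,\qquad C_n\subset E\text{ compact},\quad 0<a_n\to0 .$$ Let $M_\kappa^+(E)$ be the set of measures $\mu=\kappa\cdot m$ with $m$ a finite nonnegative Radon measure on $\mathscr B(E)$, endowed with the narrow topology, the weakest topology for which $\mu\mapsto\int\varphi\,d\mu$ is continuous for all $\varphi\in C_\kappa(E)$. A $C_0$-semigroup on $(C_\kappa(E),\tau_\kappa^{\mathscr M})$ is a family $(P_t)_{t\ge0}$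 of maps $C_\kappa(E)\to C_\kappa(E)$ with $P_0=\mathrm{id}$ and $P_sP_t=P_{s+t}$ such that $(P_t)_{0\le t\le T}$ is $\tau_\kappa^{\mathscr M}$-uniformly equicontinuous for every $T\ge0$ and $P_t\varphi\to\varphi$ in $\tau_\kappa^{\mathscr M}$ as $t\downarrow0$ for every $\varphi\in C_\kappa(E)$. It is called Markov if the $P_t$ are linear, $\varphi\ge0$ implies $P_t\varphi\ge0$, and $P_t1=1$ for all $t\ge0$. The infinitesimal generator $(L,D(L))$ of such a semigroup of linear operators is $L\varphi=\tau_\kappa^{\mathscr M}\text{-}\lim_{t\downarrow0}\frac{P_t\varphi-\varphi}t$, with $D(L)$ the set of all $\varphi\in C_\kappa(E)$ for which this limit exists. **Theorem.** Let $(P_t)_{t\ge0}$ be a Markov $C_0$-semigroup on $(C_\kappa(E),\tau_\kappa^{\mathscr M})$ with infinitesimal generator $(L,D(L))$, and let $(L_0,D(L_0))$ be a linear operator on $C_\kappa(E)$ with $D(L_0)$ dense in $(C_\kappa(E),\tau_\kappa^{\mathscr M})$ and $L_0\subset L$. Suppose that for every $x\in E$ there is exactly one $(\nu_t)_{t\ge0}\in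 C([0,\infty),M_\kappa^+(E))$ such that $$\int\varphi\,d\nu_t=\int\varphi\,d\delta_x+\int_0^t\int L_0\varphi\,d\nu_s\,ds\qquad\text{for all }t\ge0,\ \varphi\in D(L_0),$$ $\nu_t(E)=1$ for all $t\ge0$, and $\int_0^T\int_E\frac1\kappa\,d\nu_t\,dt<\infty$ for all $T>0$. Then $(L_0,D(L_0))$ is a Markov core operator for $(L,D(L))$; that is, $(L,D(L))$ is the only operator extending $(L_0,D(L_0))$ that is the infinitesimal generator of a Markov $C_0$-semigroup on $(C_\kappa(E),\tau_\kappa^{\mathscr M})$. -/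

import Mathlib

open Set Filter Topology MeasureTheory
open scoped NNReal ENNReal

noncomputable section

namespace MixedTopology

/-- Standing assumptions on the (completely regular Hausdorff) state space `E`. -/
structure SpaceHypothesis (E : Type*) [TopologicalSpace E] : Prop where
  /-- compact subsets of `E` are metrizable -/
  metrizable_of_isCompact : ∀ K : Set E, IsCompact K → TopologicalSpace.MetrizableSpace K
  /-- the Borel σ-algebra is the Baire σ-algebra, i.e. the smallest σ-algebra for which all
  continuous real functions are measurable -/
  borel_eq_baire : borel E = ⨆ f : C(E, ℝ), (borel ℝ).comap f
  /-- a real function which is continuous on every compact set is continuous -/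
  continuous_of_continuousOn_compact : ∀ f : E → ℝ,
    (∀ K : Set E, IsCompact K → ContinuousOn f K) → Continuous f

variable {E : Type*} [TopologicalSpace E]

/-- The linear space underlying `C_κ(E)`: continuous `φ : E → ℝ` with `sup |κ φ| < ∞`. -/
def weightedSubmodule (κ : C(E, Ioi (0 : ℝ))) : Submodule ℝ C(E, ℝ) where
  carrier := {φ | ∃ M : ℝ, ∀ x, |(κ x : ℝ) * φ x| ≤ M}
  zero_mem' := ⟨0, fun x => by simp⟩
  add_mem' := by
    rintro φ ψ ⟨M, hM⟩ ⟨N, hN⟩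
    refine ⟨M + N, fun x => ?_⟩
    rw [ContinuousMap.add_apply, mul_add]
    exact (abs_add_le _ _).trans (add_le_add (hM x) (hN x))
  smul_mem' := by
    rintro c φ ⟨M, hM⟩
    refine ⟨|c| * M, fun x => ?_⟩
    rw [ContinuousMap.smul_apply, smul_eq_mul, mul_left_comm, abs_mul]
    exact mul_le_mul_of_nonneg_left (hM x) (abs_nonneg c)

/-- The space `C_κ(E)`. It is a type of its own, so that it does not inherit the compact-open
topology; its topology is the mixed topology defined below. -/
def CKappa (κ : C(E, Ioi (0 : ℝ))) : Type _ := weightedSubmodule κ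

namespace CKappa

variable {κ : C(E, Ioi (0 : ℝ))}

instance : AddCommGroup (CKappa κ) := inferInstanceAs (AddCommGroup (weightedSubmodule κ))

instance : Module ℝ (CKappa κ) := inferInstanceAs (Module ℝ (weightedSubmodule κ))

instance : CoeFun (CKappa κ) (fun _ => E → ℝ) := ⟨fun φ => φ.1⟩

theorem ext {φ ψ : CKappa κ} (h : ∀ x, φ x = ψ x) : φ = ψ :=
  Subtype.ext (ContinuousMap.ext h)

theorem continuous_coe (φ : CKappa κ) : Continuous (φ : E → ℝ) := φ.1.continuous

theorem bounded (φ : CKappa κ) : ∃ M : ℝ, ∀ x, |(κ x : ℝ) * φ x| ≤ M := φ.2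

@[simp] theorem zero_apply (x : E) : (0 : CKappa κ) x = 0 := rfl

@[simp] theorem add_apply (φ ψ : CKappa κ) (x : E) : (φ + ψ) x = φ x + ψ x := rfl

@[simp] theorem neg_apply (φ : CKappa κ) (x : E) : (-φ) x = -φ x := rfl

@[simp] theorem sub_apply (φ ψ : CKappa κ) (x : E) : (φ - ψ) x = φ x - ψ x := rfl

@[simp] theorem smul_apply (c : ℝ) (φ : CKappa κ) (x : E) : (c • φ) x = c * φ x := rfl

/-- The constant function `1`, which belongs to `C_κ(E)` if `κ` is bounded. -/
def one (hκ : BddAbove (range fun x => (κ x : ℝ))) : CKappa κ :=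
  ⟨1, by
    obtain ⟨M, hM⟩ := hκ
    refine ⟨M, fun x => ?_⟩
    have h0 : (0 : ℝ) < κ x := (κ x).2
    have h1 : (κ x : ℝ) ≤ M := hM ⟨x, rfl⟩
    simpa [abs_of_pos h0] using h1⟩

@[simp] theorem one_apply (hκ : BddAbove (range fun x => (κ x : ℝ))) (x : E) :
    one hκ x = 1 := rfl

theorem bddAbove_compact (φ : CKappa κ) (C : Set E) :
    BddAbove (range fun x : C => |(κ x : ℝ) * φ x|) := by
  obtain ⟨M, hM⟩ := φ.bounded
  exact ⟨M, by rintro _ ⟨x, rfl⟩; exact hM x⟩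

/-- The seminorm `p_{κ,C}(φ) = sup_{x ∈ C} |κ(x) φ(x)|` (it is `0` if `C` is empty). -/
def compactSeminorm (κ : C(E, Ioi (0 : ℝ))) (C : TopologicalSpace.Compacts E) :
    Seminorm ℝ (CKappa κ) :=
  Seminorm.of (fun φ => ⨆ x : C, |(κ x : ℝ) * φ x|)
    (fun φ ψ => by
      refine Real.iSup_le (fun x => ?_) (add_nonneg (Real.iSup_nonneg fun x => abs_nonneg _)
        (Real.iSup_nonneg fun x => abs_nonneg _))
      rw [add_apply, mul_add]
      exact (abs_add_le _ _).trans (add_le_add (le_ciSup (φ.bddAbove_compact C) x)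
        (le_ciSup (ψ.bddAbove_compact C) x)))
    (fun c φ => by
      rw [Real.mul_iSup_of_nonneg (norm_nonneg c)]
      congr 1
      funext x
      rw [smul_apply, mul_left_comm, abs_mul, Real.norm_eq_abs])

theorem compactSeminorm_apply (C : TopologicalSpace.Compacts E) (φ : CKappa κ) :
    compactSeminorm κ C φ = ⨆ x : C, |(κ x : ℝ) * φ x| := rfl

/-- The index set of the mixed seminorms: a sequence `C_n` of compact sets and a sequence of
positive numbers `a_n → 0`. -/
structure MixedIndex (E : Type*) [TopologicalSpace E] where
  C : ℕ → TopologicalSpace.Compacts E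
  a : ℕ → ℝ
  a_pos : ∀ n, 0 < a n
  a_tendsto : Tendsto a atTop (𝓝 0)

theorem bddAbove_mixed (i : MixedIndex E) (φ : CKappa κ) :
    BddAbove (range fun n => i.a n * compactSeminorm κ (i.C n) φ) := by
  obtain ⟨M, hM⟩ := φ.bounded
  obtain ⟨A, hA⟩ := i.a_tendsto.bddAbove_range
  refine ⟨A * max M 0, ?_⟩
  rintro _ ⟨n, rfl⟩
  have h1 : compactSeminorm κ (i.C n) φ ≤ max M 0 :=
    Real.iSup_le (fun x => (hM x).trans (le_max_left _ _)) (le_max_right _ _)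
  exact (mul_le_mul_of_nonneg_left h1 (i.a_pos n).le).trans
    (mul_le_mul_of_nonneg_right (hA ⟨n, rfl⟩) (le_max_right _ _))

/-- The seminorm `p_{κ,(C_n),(a_n)}(φ) = sup_n a_n p_{κ,C_n}(φ)`. -/
def mixedSeminorm (κ : C(E, Ioi (0 : ℝ))) : SeminormFamily ℝ (CKappa κ) (MixedIndex E) :=
  fun i => Seminorm.of (fun φ => ⨆ n, i.a n * compactSeminorm κ (i.C n) φ)
    (fun φ ψ => by
      refine ciSup_le fun n => ?_
      refine (mul_le_mul_of_nonneg_left (map_add_le_add _ φ ψ) (i.a_pos n).le).trans ?_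
      rw [mul_add]
      exact add_le_add (le_ciSup (bddAbove_mixed i φ) n) (le_ciSup (bddAbove_mixed i ψ) n))
    (fun c φ => by
      rw [Real.mul_iSup_of_nonneg (norm_nonneg c)]
      congr 1
      funext n
      rw [map_smul_eq_mul, mul_left_comm])

theorem mixedSeminorm_apply (i : MixedIndex E) (φ : CKappa κ) :
    mixedSeminorm κ i φ = ⨆ n, i.a n * compactSeminorm κ (i.C n) φ := rfl

/-- The index with all `C_n` equal to `K` and `a_n = 1 / (n + 1)`. -/
def MixedIndex.const (K : TopologicalSpace.Compacts E) : MixedIndex E where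
  C _ := K
  a n := 1 / ((n : ℝ) + 1)
  a_pos n := by positivity
  a_tendsto := tendsto_one_div_add_atTop_nhds_zero_nat

instance : Nonempty (MixedIndex E) := ⟨MixedIndex.const ⊥⟩

/-- The mixed topology: the locally convex topology defined by the mixed seminorms. -/
instance : TopologicalSpace (CKappa κ) := (mixedSeminorm κ).moduleFilterBasis.topology

theorem withSeminorms_mixed : WithSeminorms (mixedSeminorm κ) := ⟨rfl⟩

instance : IsTopologicalAddGroup (CKappa κ) := withSeminorms_mixed.topologicalAddGroup

instance : ContinuousSMul ℝ (CKappa κ) := withSeminorms_mixed.continuousSMul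

instance : T2Space (CKappa κ) := by
  have : T1Space (CKappa κ) := by
    refine withSeminorms_mixed.T1_of_separating fun φ hφ => ?_
    obtain ⟨x, hx⟩ : ∃ x, φ x ≠ 0 := by
      by_contra! h
      exact hφ (ext h)
    refine ⟨MixedIndex.const ⟨{x}, isCompact_singleton⟩, ne_of_gt ?_⟩
    have h1 : |(κ x : ℝ) * φ x| ≤ compactSeminorm κ ⟨{x}, isCompact_singleton⟩ φ :=
      le_ciSup (φ.bddAbove_compact {x}) ⟨x, rfl⟩
    have h2 : 0 < |(κ x : ℝ) * φ x| := abs_pos.mpr (mul_ne_zero (ne_of_gt (κ x).2) hx)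
    refine lt_of_lt_of_le ?_ (le_ciSup (bddAbove_mixed _ φ) 0)
    exact mul_pos (MixedIndex.a_pos _ 0) (h2.trans_le h1)
  infer_instance

end CKappa

open CKappa

variable {κ : C(E, Ioi (0 : ℝ))}

/-- A `C₀`-semigroup of (possibly nonlinear) operators on `C_κ(E)` with the mixed topology. -/
structure IsC0Semigroup (P : ℝ≥0 → CKappa κ → CKappa κ) : Prop where
  map_zero : ∀ φ, P 0 φ = φ
  map_add : ∀ s t φ, P s (P t φ) = P (s + t) φ
  /-- local uniform equicontinuity -/
  equicontinuous : ∀ (T : ℝ≥0) (ε : ℝ), 0 < ε → ∀ i : MixedIndex E,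
    ∃ (j : MixedIndex E) (δ : ℝ), 0 < δ ∧ ∀ t ≤ T, ∀ φ₁ φ₂ : CKappa κ,
      mixedSeminorm κ j (φ₁ - φ₂) < δ → mixedSeminorm κ i (P t φ₁ - P t φ₂) < ε
  /-- strong right continuity at `0` -/
  tendsto_zero : ∀ φ, Tendsto (fun t => P t φ) (𝓝[>] 0) (𝓝 φ)

/-- A Markov `C₀`-semigroup (for bounded `κ`): a `C₀`-semigroup of positivity preserving linear
operators with `P_t 1 = 1`. -/
structure IsMarkovC0Semigroup (hκ : BddAbove (range fun x => (κ x : ℝ)))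
    (P : ℝ≥0 → CKappa κ →ₗ[ℝ] CKappa κ) : Prop where
  isC0Semigroup : IsC0Semigroup fun t => ⇑(P t)
  nonneg : ∀ t φ, (∀ x, 0 ≤ φ x) → ∀ x, 0 ≤ P t φ x
  map_one : ∀ t, P t (one hκ) = one hκ

/-- `(P_t φ - φ) / t → ψ` in the mixed topology as `t → 0`, `t > 0`. -/
def HasGeneratorAt (P : ℝ≥0 → CKappa κ →ₗ[ℝ] CKappa κ) (φ ψ : CKappa κ) : Prop :=
  Tendsto (fun t : ℝ≥0 => (t : ℝ)⁻¹ • (P t φ - φ)) (𝓝[>] 0) (𝓝 ψ)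

theorem HasGeneratorAt.add {P : ℝ≥0 → CKappa κ →ₗ[ℝ] CKappa κ} {φ φ' ψ ψ' : CKappa κ}
    (h : HasGeneratorAt P φ ψ) (h' : HasGeneratorAt P φ' ψ') :
    HasGeneratorAt P (φ + φ') (ψ + ψ') := by
  refine (Tendsto.add h h').congr fun t => ?_
  rw [map_add, ← smul_add]
  congr 1
  abel

theorem HasGeneratorAt.smul {P : ℝ≥0 → CKappa κ →ₗ[ℝ] CKappa κ} {φ ψ : CKappa κ} (c : ℝ)
    (h : HasGeneratorAt P φ ψ) : HasGeneratorAt P (c • φ) (c • ψ) := by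
  refine (Tendsto.const_smul h c).congr fun t => ?_
  rw [map_smul, ← smul_sub, smul_comm]

theorem HasGeneratorAt.unique {P : ℝ≥0 → CKappa κ →ₗ[ℝ] CKappa κ} {φ ψ ψ' : CKappa κ}
    (h : HasGeneratorAt P φ ψ) (h' : HasGeneratorAt P φ ψ') : ψ = ψ' :=
  tendsto_nhds_unique h h'

/-- The infinitesimal generator `(L, D(L))` of a family of linear operators on `C_κ(E)`. -/
def generator (P : ℝ≥0 → CKappa κ →ₗ[ℝ] CKappa κ) : CKappa κ →ₗ.[ℝ] CKappa κ where
  domain :=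
    { carrier := {φ | ∃ ψ, HasGeneratorAt P φ ψ}
      zero_mem' := ⟨0, by simp [HasGeneratorAt]⟩
      add_mem' := fun ⟨ψ, h⟩ ⟨ψ', h'⟩ => ⟨ψ + ψ', h.add h'⟩
      smul_mem' := fun c _ ⟨ψ, h⟩ => ⟨c • ψ, h.smul c⟩ }
  toFun :=
    { toFun := fun φ => Classical.choose φ.2
      map_add' := fun φ φ' => (Classical.choose_spec (φ + φ').2).unique
        ((Classical.choose_spec φ.2).add (Classical.choose_spec φ'.2))
      map_smul' := fun c φ => (Classical.choose_spec (c • φ).2).unique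
        ((Classical.choose_spec φ.2).smul c) }

/-- `(φ, ψ)` is in the graph of the generator iff `(P_t φ - φ) / t → ψ`. -/
theorem mem_graph_generator (P : ℝ≥0 → CKappa κ →ₗ[ℝ] CKappa κ) (φ ψ : CKappa κ) :
    (φ, ψ) ∈ (generator P).graph ↔ HasGeneratorAt P φ ψ := by
  rw [LinearPMap.mem_graph_iff]
  constructor
  · rintro ⟨y, rfl, rfl⟩
    exact Classical.choose_spec y.2
  · intro h
    exact ⟨⟨φ, ψ, h⟩, rfl, (Classical.choose_spec (⟨ψ, h⟩ : ∃ ψ, HasGeneratorAt P φ ψ)).unique h⟩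

/-- `L₀` is a Markov core operator for `L`: it is densely defined, `L₀ ⊂ L`, and `L` is the only
operator extending `L₀` which is the generator of a Markov `C₀`-semigroup. -/
structure IsMarkovCoreOperator (hκ : BddAbove (range fun x => (κ x : ℝ)))
    (L₀ L : CKappa κ →ₗ.[ℝ] CKappa κ) : Prop where
  dense : Dense (L₀.domain : Set (CKappa κ))
  le : L₀ ≤ L
  isGenerator : ∃ P : ℝ≥0 → CKappa κ →ₗ[ℝ] CKappa κ, IsMarkovC0Semigroup hκ P ∧ generator P = L
  unique : ∀ Q : ℝ≥0 → CKappa κ →ₗ[ℝ] CKappa κ, IsMarkovC0Semigroup hκ Q →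
    L₀ ≤ generator Q → generator Q = L

section Measures

variable [MeasurableSpace E]

/-- `M_κ⁺(E) = κ · M_b⁺(E)`, where `M_b⁺(E)` is the set of finite nonnegative Radon measures
(inner regular on Borel sets with respect to compact sets). -/
def KappaMeasure (κ : C(E, Ioi (0 : ℝ))) : Type _ :=
  {μ : Measure E // ∃ m : Measure E, IsFiniteMeasure m ∧ m.InnerRegular ∧
    μ = m.withDensity fun x => ENNReal.ofReal (κ x)}

/-- The underlying measure. -/
def KappaMeasure.toMeasure (μ : KappaMeasure κ) : Measure E := μ.1

/-- The narrow topology: the weakest topology for which `μ ↦ ∫ φ dμ` is continuous for all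
`φ ∈ C_κ(E)`. -/
instance : TopologicalSpace (KappaMeasure κ) :=
  ⨅ φ : CKappa κ, TopologicalSpace.induced (fun μ => ∫ y, φ y ∂μ.toMeasure) inferInstance

/-- `ν ∈ C([0,∞), M_κ⁺(E))` is a solution of the Fokker–Planck–Kolmogorov equation for `L₀` with
initial datum `δ_x`, it consists of probability measures, and
`∫₀ᵀ ∫ (1/κ) dν_t dt < ∞` for all `T > 0`. -/
structure IsFPKSolution (L₀ : CKappa κ →ₗ.[ℝ] CKappa κ) (x : E)
    (ν : C(ℝ≥0, KappaMeasure κ)) : Prop where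
  equation : ∀ (t : ℝ≥0) (φ : L₀.domain),
    ∫ y, (φ : CKappa κ) y ∂(ν t).toMeasure = ∫ y, (φ : CKappa κ) y ∂(Measure.dirac x) +
      ∫ s in (0 : ℝ)..t, ∫ y, L₀ φ y ∂(ν s.toNNReal).toMeasure
  mass : ∀ t, (ν t).toMeasure univ = 1
  integrability : ∀ T : ℝ, 0 < T →
    ∫⁻ t in Ioc 0 T, ∫⁻ y, ENNReal.ofReal (1 / (κ y : ℝ)) ∂(ν t.toNNReal).toMeasure < ∞

end Measures

end MixedTopology

end

/-!
The transition measures of a Markov `C₀`-semigroup whose generator extends `L₀` are determined by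
the Fokker–Planck–Kolmogorov equation for `L₀`, so two such semigroups coincide, and with them
their generators (`IsMarkovC0Semigroup.eq_of_unique_isFPKSolution`).

For fixed `t` and `x` the functional `φ ↦ P_t φ(x)` is positive and continuous in the mixed
topology. After multiplication by `κ` it becomes a positive functional on bounded continuous
functions which is tight: a mixed seminorm sees only finitely many compact sets up to a small
error. A tight positive functional is the integral against a finite inner regular measure
(`IsTightFunctional.exists_measure`): the Riesz–Markov–Kakutani theorem gives a regular measure on
the Stone–Čech compactification, tightness makes the complement of `E` null for it, and it can be
pulled back along the embedding of `E`. This gives measures `ν_t ∈ M_κ⁺(E)` with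
`P_t φ(x) = ∫ φ dν_t`.

Local equicontinuity turns right continuity at `0` into continuity of `t ↦ P_t φ`, hence `ν` is
narrowly continuous. Since `P_s L φ(x)` is the continuous right derivative of `s ↦ P_s φ(x)`,
integration gives the equation. The mass is `P_t 1(x) = 1`, and the integral of `1 / κ` against
`ν_t` is `P_t (1 / κ)(x)`, which is bounded on compact time intervals as `1 / κ ∈ C_κ(E)`.
-/

/-! ### Pulling a measure back along an embedding of full measure -/

section Pullback

variable {X Y : Type*} [TopologicalSpace X] [MeasurableSpace X] [BorelSpace X]
  [TopologicalSpace Y] [MeasurableSpace Y] [BorelSpace Y] {i : X → Y} {μ : Measure Y}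

/-- The range itself need not be measurable; that its complement is null is enough for
`Measure.comap i μ` not to take its junk value `0`. -/
theorem Topology.IsEmbedding.nullMeasurableSet_image (hi : IsEmbedding i)
    (hμ : μ (range i)ᶜ = 0) (s : Set X) (hs : MeasurableSet s) : NullMeasurableSet (i '' s) μ := by
  have h : MeasurableSet[MeasurableSpace.comap i (borel Y)] s := by
    have hX : borel X = MeasurableSpace.comap i (borel Y) := by
      rw [hi.eq_induced]
      exact borel_comap
    rwa [← hX, ← BorelSpace.measurable_eq]
  obtain ⟨A, hA, rfl⟩ := h
  rw [← BorelSpace.measurable_eq] at hA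
  rw [image_preimage_eq_inter_range]
  refine hA.nullMeasurableSet.inter ?_
  simpa using (NullMeasurableSet.of_null hμ).compl

theorem Topology.IsEmbedding.map_comap_measure (hi : IsEmbedding i) (hμ : μ (range i)ᶜ = 0) :
    (μ.comap i).map i = μ := by
  ext s hs
  rw [Measure.map_apply hi.continuous.measurable hs,
    Measure.comap_preimage i μ hi.injective hi.continuous.measurable
      (hi.nullMeasurableSet_image hμ) hs]
  exact measure_inter_conull hμ

theorem Topology.IsEmbedding.isFiniteMeasure_comap [IsFiniteMeasure μ] (hi : IsEmbedding i)
    (hμ : μ (range i)ᶜ = 0) : IsFiniteMeasure (μ.comap i) := by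
  refine ⟨?_⟩
  rw [Measure.comap_apply₀ i μ hi.injective (hi.nullMeasurableSet_image hμ)
    MeasurableSet.univ.nullMeasurableSet]
  exact measure_lt_top μ _

theorem Topology.IsEmbedding.innerRegular_comap [μ.InnerRegular] (hi : IsEmbedding i)
    (hμ : μ (range i)ᶜ = 0) [T2Space X] : (μ.comap i).InnerRegular := by
  refine ⟨fun s hs r hr => ?_⟩
  have hnull := hi.nullMeasurableSet_image hμ
  rw [Measure.comap_apply₀ i μ hi.injective hnull hs.nullMeasurableSet] at hr
  obtain ⟨A, hAs, hA, hAe⟩ := (hnull s hs).exists_measurable_subset_ae_eq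
  rw [← measure_congr hAe] at hr
  obtain ⟨C, hCA, hC, hrC⟩ := hA.exists_lt_isCompact hr
  have hCr : C ⊆ range i := (hCA.trans hAs).trans (image_subset_range i s)
  have hC' : IsCompact (i ⁻¹' C) := hi.isInducing.isCompact_preimage' hC hCr
  refine ⟨i ⁻¹' C, fun x hx => ?_, hC', ?_⟩
  · obtain ⟨y, hy, hyx⟩ := hAs (hCA hx)
    rwa [← hi.injective hyx]
  · rwa [Measure.comap_apply₀ i μ hi.injective hnull hC'.measurableSet.nullMeasurableSet,
      image_preimage_eq_of_subset hCr]

theorem Topology.IsEmbedding.integral_comap_measure (hi : IsEmbedding i)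
    (hμ : μ (range i)ᶜ = 0) (f : C(Y, ℝ)) : ∫ x, f (i x) ∂(μ.comap i) = ∫ y, f y ∂μ := by
  conv_rhs => rw [← hi.map_comap_measure hμ]
  exact (integral_map hi.continuous.measurable.aemeasurable
    f.continuous.measurable.aestronglyMeasurable).symm

end Pullback

/-! ### Tight positive functionals on bounded continuous functions -/

section Representation

open CompactlySupported

/-- A functional is tight if it is uniformly small on the functions with values in `[0, 1]` that
vanish on a suitable compact set. -/
def IsTightFunctional {E : Type*} [TopologicalSpace E]
    (Λ : BoundedContinuousFunction E ℝ →ₗ[ℝ] ℝ) : Prop :=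
  ∀ ε : ℝ, 0 < ε → ∃ K : Set E, IsCompact K ∧ ∀ f : BoundedContinuousFunction E ℝ,
    (∀ x ∈ K, f x = 0) → (∀ x, f x ∈ Icc (0 : ℝ) 1) → Λ f ≤ ε

/-- A bounded continuous function extends to the Stone-Čech compactification. -/
theorem BoundedContinuousFunction.exists_stoneCech_extension {E : Type*} [TopologicalSpace E]
    (f : BoundedContinuousFunction E ℝ) :
    ∃ g : C(StoneCech E, ℝ), ∀ x, g (stoneCechUnit x) = f x := by
  have hf : ∀ x, f x ∈ Icc (-‖f‖) ‖f‖ := fun x => abs_le.mp (f.norm_coe_le_norm x)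
  have hc : Continuous fun x => (⟨f x, hf x⟩ : Icc (-‖f‖) ‖f‖) := f.continuous.subtype_mk hf
  refine ⟨⟨fun y => ((stoneCechExtend hc y : Icc (-‖f‖) ‖f‖) : ℝ),
    continuous_subtype_val.comp (continuous_stoneCechExtend hc)⟩, fun x => ?_⟩
  simp [stoneCechExtend_stoneCechUnit]

/-- Riesz representation on a completely regular Hausdorff space: the functional, transported to
the Stone-Čech compactification, is given by a regular measure there, and tightness says that
this measure sits on a countable union of compact subsets of `E`. -/
theorem IsTightFunctional.exists_measure {E : Type*} [TopologicalSpace E] [T35Space E]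
    [MeasurableSpace E] [BorelSpace E] {Λ : BoundedContinuousFunction E ℝ →ₗ[ℝ] ℝ}
    (hΛ : IsTightFunctional Λ) (hpos : ∀ f, (∀ x, 0 ≤ f x) → 0 ≤ Λ f) :
    ∃ m : Measure E, IsFiniteMeasure m ∧ m.InnerRegular ∧ ∀ f, ∫ x, f x ∂m = Λ f := by
  let _ : MeasurableSpace (StoneCech E) := borel _
  have : BorelSpace (StoneCech E) := ⟨rfl⟩
  have hi : IsEmbedding (stoneCechUnit : E → StoneCech E) := isEmbedding_stoneCechUnit
  let pull : C_c(StoneCech E, ℝ) →ₗ[ℝ] BoundedContinuousFunction E ℝ :=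
    { toFun := fun f => (BoundedContinuousFunction.mkOfCompact f.toContinuousMap).compContinuous
        ⟨stoneCechUnit, continuous_stoneCechUnit⟩
      map_add' := fun _ _ => rfl
      map_smul' := fun _ _ => rfl }
  let Λ' : C_c(StoneCech E, ℝ) →ₚ[ℝ] ℝ :=
    PositiveLinearMap.mk₀ (Λ ∘ₗ pull) fun f hf => hpos _ fun x => hf (stoneCechUnit x)
  let μ := RealRMK.rieszMeasure Λ'
  have hint : ∀ (g : C(StoneCech E, ℝ)) (f : BoundedContinuousFunction E ℝ),
      (∀ x, g (stoneCechUnit x) = f x) → ∫ y, g y ∂μ = Λ f := by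
    intro g f hgf
    refine (RealRMK.integral_rieszMeasure Λ'
      (CompactlySupportedContinuousMap.continuousMapEquiv g)).trans ?_
    change Λ _ = Λ f
    congr 1
    ext x
    exact hgf x
  have hfin : IsFiniteMeasure μ := inferInstance
  have hμ : μ (range (stoneCechUnit : E → StoneCech E))ᶜ = 0 := by
    refine le_antisymm (le_of_forall_pos_le_add fun ε hε => ?_) zero_le
    rw [zero_add]
    obtain rfl | hεtop := eq_or_ne ε ⊤
    · exact le_top
    obtain ⟨K, hK, hKΛ⟩ := hΛ ε.toReal (ENNReal.toReal_pos hε.ne' hεtop)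
    have hK' : IsClosed (stoneCechUnit '' K) := (hK.image continuous_stoneCechUnit).isClosed
    refine (measure_mono (compl_subset_compl.mpr (image_subset_range _ K))).trans ?_
    rw [hK'.isOpen_compl.measure_eq_iSup_isCompact]
    refine iSup₂_le fun C hCK => iSup_le fun hC => ?_
    obtain ⟨g, hg0, hg1, hg⟩ := exists_continuous_zero_one_of_isClosed hK' hC.isClosed
      (disjoint_compl_right.mono_right hCK)
    let f := (BoundedContinuousFunction.mkOfCompact g).compContinuous
      ⟨stoneCechUnit, continuous_stoneCechUnit⟩
    have h1 : Λ f ≤ ε.toReal :=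
      hKΛ f (fun x hx => hg0 (mem_image_of_mem _ hx)) fun x => hg (stoneCechUnit x)
    have hgi : Integrable g μ := BoundedContinuousFunction.integrable μ
      (BoundedContinuousFunction.mkOfCompact g)
    have h2 : μ C ≤ ENNReal.ofReal (∫ y, g y ∂μ) := by
      rw [ofReal_integral_eq_lintegral_ofReal hgi (ae_of_all _ fun y => (hg y).1),
        ← lintegral_indicator_one hC.measurableSet]
      refine lintegral_mono fun y => ?_
      by_cases hy : y ∈ C
      · simp [hy, hg1 hy]
      · simp [hy]
    rw [hint g f fun _ => rfl] at h2
    exact h2.trans (ENNReal.ofReal_le_of_le_toReal h1)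
  refine ⟨μ.comap stoneCechUnit, hi.isFiniteMeasure_comap hμ, hi.innerRegular_comap hμ,
    fun f => ?_⟩
  obtain ⟨g, hg⟩ := f.exists_stoneCech_extension
  rw [← hint g f hg, ← hi.integral_comap_measure hμ g]
  simp only [hg]

end Representation

noncomputable section

namespace MixedTopology

open CKappa

variable {E : Type*} [TopologicalSpace E] {κ : C(E, Ioi (0 : ℝ))}

/-! ### Continuous functionals on `C_κ(E)` are integrals -/

namespace CKappa

/-- The isomorphism `f ↦ f / κ` from bounded continuous functions onto `C_κ(E)`, as a linear
map. -/
def divWeight (κ : C(E, Ioi (0 : ℝ))) : BoundedContinuousFunction E ℝ →ₗ[ℝ] CKappa κ where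
  toFun f := ⟨⟨fun x => f x / (κ x : ℝ), f.continuous.div
    (continuous_subtype_val.comp κ.continuous) fun x => ne_of_gt (κ x).2⟩, ‖f‖, fun x => by
      have : (κ x : ℝ) ≠ 0 := ne_of_gt (κ x).2
      simpa [mul_div_cancel₀ _ this] using f.norm_coe_le_norm x⟩
  map_add' f g := ext fun x => add_div (f x) (g x) (κ x : ℝ)
  map_smul' c f := ext fun x => mul_div_assoc c (f x) (κ x : ℝ)

theorem divWeight_apply (f : BoundedContinuousFunction E ℝ) (x : E) :
    divWeight κ f x = f x / (κ x : ℝ) := rfl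

theorem weight_mul_divWeight (f : BoundedContinuousFunction E ℝ) (x : E) :
    (κ x : ℝ) * divWeight κ f x = f x :=
  mul_div_cancel₀ _ (ne_of_gt (κ x).2)

/-- The bounded continuous function `κ φ`. -/
def mulWeight (φ : CKappa κ) : BoundedContinuousFunction E ℝ :=
  BoundedContinuousFunction.ofNormedAddCommGroup (fun x => (κ x : ℝ) * φ x)
    ((continuous_subtype_val.comp κ.continuous).mul φ.continuous_coe) φ.bounded.choose
    φ.bounded.choose_spec

theorem mulWeight_apply (φ : CKappa κ) (x : E) : mulWeight φ x = (κ x : ℝ) * φ x := rfl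

theorem divWeight_mulWeight (φ : CKappa κ) : divWeight κ (mulWeight φ) = φ :=
  ext fun x => mul_div_cancel_left₀ (φ x) (ne_of_gt (κ x).2)

theorem abs_weight_mul_apply_le (φ : CKappa κ) {x : E} {C : TopologicalSpace.Compacts E}
    (hx : x ∈ C) : |(κ x : ℝ) * φ x| ≤ compactSeminorm κ C φ :=
  le_ciSup (φ.bddAbove_compact C) ⟨x, hx⟩

/-- Only finitely many of the compact sets of a mixed seminorm matter, up to a given error, on
the unit ball of the weighted sup norm. -/
theorem exists_isCompact_mixedSeminorm_lt (i : MixedIndex E) {r : ℝ} (hr : 0 < r) :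
    ∃ K : Set E, IsCompact K ∧ ∀ φ : CKappa κ, (∀ x ∈ K, φ x = 0) →
      (∀ x, |(κ x : ℝ) * φ x| ≤ 1) → mixedSeminorm κ i φ < r := by
  obtain ⟨N, hN⟩ := eventually_atTop.mp (i.a_tendsto.eventually_lt_const (half_pos hr))
  refine ⟨⋃ n ∈ Finset.range N, (i.C n : Set E),
    (Finset.range N).isCompact_biUnion fun n _ => (i.C n).isCompact, fun φ hφ hφ1 => ?_⟩
  refine lt_of_le_of_lt (ciSup_le fun n => ?_) (half_lt_self hr)
  obtain hn | hn := lt_or_ge n N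
  · have h0 : compactSeminorm κ (i.C n) φ ≤ 0 := Real.iSup_le (fun x => by
      have : φ x = 0 := hφ x (mem_biUnion (Finset.mem_coe.mpr (Finset.mem_range.mpr hn)) x.2)
      simp [this]) le_rfl
    exact (mul_nonpos_of_nonneg_of_nonpos (i.a_pos n).le h0).trans (half_pos hr).le
  · have h1 : compactSeminorm κ (i.C n) φ ≤ 1 := Real.iSup_le (fun x => hφ1 x) zero_le_one
    calc i.a n * compactSeminorm κ (i.C n) φ ≤ i.a n * 1 :=
          mul_le_mul_of_nonneg_left h1 (i.a_pos n).le
      _ ≤ r / 2 := by rw [mul_one]; exact (hN n hn).le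

theorem isTightFunctional_comp_divWeight {Λ : CKappa κ →ₗ[ℝ] ℝ} (hΛ : Continuous Λ) :
    IsTightFunctional (Λ ∘ₗ divWeight κ) := by
  intro ε hε
  have h0 : ∀ᶠ φ in 𝓝 (0 : CKappa κ), Λ φ < ε :=
    (hΛ.tendsto 0).eventually_lt_const (by simpa using hε)
  obtain ⟨⟨s, r⟩, hr, hs⟩ := withSeminorms_mixed.hasBasis_zero_ball.mem_iff.mp h0
  choose K hK hKs using fun i : MixedIndex E => exists_isCompact_mixedSeminorm_lt (κ := κ) i hr
  refine ⟨⋃ i ∈ s, K i, s.isCompact_biUnion fun i _ => hK i, fun f hf hf1 => ?_⟩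
  have hmem : divWeight κ f ∈ (s.sup (mixedSeminorm κ)).ball 0 r := by
    rw [Seminorm.mem_ball_zero]
    refine Seminorm.finset_sup_apply_lt hr fun i hi => hKs i _ (fun x hx => ?_) fun x => ?_
    · rw [divWeight_apply, hf x (mem_biUnion (Finset.mem_coe.mpr hi) hx), zero_div]
    · rw [weight_mul_divWeight, abs_of_nonneg (hf1 x).1]
      exact (hf1 x).2
  exact (hs hmem : Λ (divWeight κ f) < ε).le

theorem continuous_eval (x : E) : Continuous fun φ : CKappa κ => φ x := by
  rw [continuous_iff_continuousAt]
  intro φ₀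
  have hκ : (0 : ℝ) < κ x := (κ x).2
  rw [ContinuousAt, Metric.tendsto_nhds]
  intro ε hε
  have h := (withSeminorms_mixed.tendsto_nhds (fun φ : CKappa κ => φ) φ₀).mp tendsto_id
    (MixedIndex.const ⟨{x}, isCompact_singleton⟩) (κ x * ε) (mul_pos hκ hε)
  filter_upwards [h] with φ hφ
  -- the first coefficient of the constant index is `1`
  have h1 : compactSeminorm κ ⟨{x}, isCompact_singleton⟩ (φ - φ₀) ≤
      mixedSeminorm κ (MixedIndex.const ⟨{x}, isCompact_singleton⟩) (φ - φ₀) := by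
    have := le_ciSup (bddAbove_mixed (MixedIndex.const ⟨{x}, isCompact_singleton⟩) (φ - φ₀)) 0
    simpa [MixedIndex.const, mixedSeminorm_apply] using this
  have h2 := (abs_weight_mul_apply_le (φ - φ₀) (C := ⟨{x}, isCompact_singleton⟩)
    (mem_singleton x)).trans_lt (h1.trans_lt hφ)
  rw [abs_mul, abs_of_pos hκ] at h2
  exact lt_of_mul_lt_mul_left h2 hκ.le

/-- The function `1 / κ`. It belongs to `C_κ(E)` for every weight. -/
def invWeight (κ : C(E, Ioi (0 : ℝ))) : CKappa κ :=
  divWeight κ (BoundedContinuousFunction.const E 1)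

end CKappa

section Measures

variable [MeasurableSpace E] [BorelSpace E]

theorem measurable_ofReal_weight (κ : C(E, Ioi (0 : ℝ))) :
    Measurable fun x => ENNReal.ofReal (κ x : ℝ) :=
  (continuous_subtype_val.comp κ.continuous).measurable.ennreal_ofReal

theorem KappaMeasure.integrable (μ : KappaMeasure κ) (φ : CKappa κ) :
    Integrable φ μ.toMeasure := by
  obtain ⟨μ, m, hm, -, rfl⟩ := μ
  refine (integrable_withDensity_iff_integrable_smul₀' (measurable_ofReal_weight κ).aemeasurable
    (ae_of_all _ fun _ => ENNReal.ofReal_lt_top)).mpr ?_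
  refine (BoundedContinuousFunction.integrable m (mulWeight φ)).congr (ae_of_all _ fun x => ?_)
  simp [mulWeight_apply, ENNReal.toReal_ofReal (le_of_lt (κ x).2)]

theorem exists_kappaMeasure_integral_eq [T35Space E] {Λ : CKappa κ →ₗ[ℝ] ℝ}
    (hΛ : Continuous Λ) (hpos : ∀ φ : CKappa κ, (∀ x, 0 ≤ φ x) → 0 ≤ Λ φ) :
    ∃ μ : KappaMeasure κ, ∀ φ : CKappa κ, ∫ x, φ x ∂μ.toMeasure = Λ φ := by
  obtain ⟨m, hm, hmr, hmΛ⟩ := (isTightFunctional_comp_divWeight hΛ).exists_measure fun f hf =>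
    hpos _ fun x => div_nonneg (hf x) (le_of_lt (κ x).2)
  refine ⟨⟨_, m, hm, hmr, rfl⟩, fun φ => ?_⟩
  refine (integral_withDensity_eq_integral_toReal_smul (measurable_ofReal_weight κ)
    (ae_of_all _ fun _ => ENNReal.ofReal_lt_top) φ).trans ?_
  have h := hmΛ (mulWeight φ)
  rw [LinearMap.comp_apply, divWeight_mulWeight] at h
  rw [← h]
  refine integral_congr_ae (ae_of_all _ fun x => ?_)
  simp [mulWeight_apply, ENNReal.toReal_ofReal (le_of_lt (κ x).2)]

end Measures

/-! ### Orbits of a `C₀`-semigroup -/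

section Orbits

theorem IsC0Semigroup.continuous {P : ℝ≥0 → CKappa κ → CKappa κ} (hP : IsC0Semigroup P)
    (t : ℝ≥0) : Continuous (P t) := by
  refine continuous_iff_continuousAt.mpr fun φ₀ => ?_
  refine (withSeminorms_mixed.tendsto_nhds _ _).mpr fun i ε hε => ?_
  obtain ⟨j, δ, hδ, h⟩ := hP.equicontinuous t ε hε i
  filter_upwards [(withSeminorms_mixed.tendsto_nhds (fun φ : CKappa κ => φ) φ₀).mp tendsto_id
    j δ hδ] with φ hφ using h t le_rfl φ φ₀ hφ

theorem IsC0Semigroup.tendsto_nhds_zero {P : ℝ≥0 → CKappa κ → CKappa κ}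
    (hP : IsC0Semigroup P) (φ : CKappa κ) : Tendsto (fun t => P t φ) (𝓝 0) (𝓝 φ) := by
  have h : 𝓝 (0 : ℝ≥0) = pure 0 ⊔ 𝓝[>] 0 := by
    rw [← nhdsWithin_singleton, ← nhdsWithin_union, singleton_union, Ioi_insert]
    have : Ici (0 : ℝ≥0) = univ := eq_univ_of_forall fun t => mem_Ici.mpr zero_le
    rw [this, nhdsWithin_univ]
  rw [h, tendsto_sup]
  refine ⟨?_, hP.tendsto_zero φ⟩
  rw [tendsto_pure_left]
  intro s hs
  rw [hP.map_zero]
  exact mem_of_mem_nhds hs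

/-- Right continuity at `0` propagates to two-sided continuity because the operators are
equicontinuous on bounded time intervals. -/
theorem IsC0Semigroup.continuous_orbit {P : ℝ≥0 → CKappa κ → CKappa κ} (hP : IsC0Semigroup P)
    (φ : CKappa κ) : Continuous fun t => P t φ := by
  refine continuous_iff_continuousAt.mpr fun t₀ => ?_
  refine (withSeminorms_mixed.tendsto_nhds _ _).mpr fun i ε hε => ?_
  obtain ⟨j, δ, hδ, h⟩ := hP.equicontinuous (t₀ + 1) ε hε i
  have h0 := (withSeminorms_mixed.tendsto_nhds _ _).mp (hP.tendsto_nhds_zero φ) j δ hδ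
  have hr : Tendsto (fun t => t - t₀) (𝓝 t₀) (𝓝 0) := by
    have hc : Continuous fun t : ℝ≥0 => t - t₀ := continuous_id.sub continuous_const
    simpa using hc.tendsto t₀
  have hl : Tendsto (fun t => t₀ - t) (𝓝 t₀) (𝓝 0) := by
    have hc : Continuous fun t : ℝ≥0 => t₀ - t := continuous_const.sub continuous_id
    simpa using hc.tendsto t₀
  filter_upwards [hr.eventually h0, hl.eventually h0,
    eventually_le_nhds (lt_add_one t₀)] with t htr htl ht1
  obtain ht | ht := le_total t₀ t
  · have : P t φ = P t₀ (P (t - t₀) φ) := by rw [hP.map_add, add_tsub_cancel_of_le ht]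
    rw [this]
    exact h t₀ (le_add_of_nonneg_right zero_le_one) _ _ htr
  · have : P t₀ φ = P t (P (t₀ - t) φ) := by rw [hP.map_add, add_tsub_cancel_of_le ht]
    rw [this, map_sub_rev]
    exact h t ht1 _ _ htl

variable {P : ℝ≥0 → CKappa κ →ₗ[ℝ] CKappa κ}

theorem HasGeneratorAt.hasDerivWithinAt_orbit (hP : IsC0Semigroup fun t => ⇑(P t))
    {φ ψ : CKappa κ} (h : HasGeneratorAt P φ ψ) (x : E) {s : ℝ} (hs : 0 ≤ s) :
    HasDerivWithinAt (fun r : ℝ => P r.toNNReal φ x) (P s.toNNReal ψ x) (Ioi s) s := by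
  rw [hasDerivWithinAt_iff_tendsto_slope' self_notMem_Ioi]
  have hsub : Tendsto (fun u : ℝ => (u - s).toNNReal) (𝓝[>] s) (𝓝[>] 0) := by
    refine tendsto_nhdsWithin_iff.mpr ⟨?_, ?_⟩
    · have hc : Continuous fun u : ℝ => (u - s).toNNReal :=
        continuous_real_toNNReal.comp (continuous_id.sub continuous_const)
      simpa using (hc.tendsto s).mono_left nhdsWithin_le_nhds
    · filter_upwards [self_mem_nhdsWithin] with u hu
      exact Real.toNNReal_pos.mpr (sub_pos.mpr hu)
  have hlim := (((continuous_eval x).comp (hP.continuous s.toNNReal)).tendsto ψ).comp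
    (h.comp hsub)
  refine hlim.congr' ?_
  filter_upwards [self_mem_nhdsWithin] with u hu
  have hus : 0 ≤ u - s := (sub_pos.mpr hu).le
  have hadd : s.toNNReal + (u - s).toNNReal = u.toNNReal := by
    rw [← Real.toNNReal_add hs hus, add_sub_cancel]
  have hsg : P s.toNNReal (P (u - s).toNNReal φ) = P u.toNNReal φ := by
    rw [← hadd]
    exact hP.map_add _ _ φ
  simp only [Function.comp_apply, map_smul, map_sub, hsg, CKappa.smul_apply, CKappa.sub_apply,
    Real.coe_toNNReal _ hus, slope_def_field]
  rw [div_eq_inv_mul]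

/-- Along the orbits of points of the domain, `P_t φ - φ = ∫₀ᵗ P_s L φ ds`, pointwise on `E`. -/
theorem HasGeneratorAt.integral_orbit (hP : IsC0Semigroup fun t => ⇑(P t)) {φ ψ : CKappa κ}
    (h : HasGeneratorAt P φ ψ) (x : E) (t : ℝ≥0) :
    ∫ s in (0 : ℝ)..t, P s.toNNReal ψ x = P t φ x - φ x := by
  have hcont : ∀ χ : CKappa κ, Continuous fun s : ℝ => P s.toNNReal χ x := fun χ =>
    (continuous_eval x).comp ((hP.continuous_orbit χ).comp continuous_real_toNNReal)
  rw [intervalIntegral.integral_eq_sub_of_hasDeriv_right_of_le t.coe_nonneg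
    (hcont φ).continuousOn (fun s hs => h.hasDerivWithinAt_orbit hP x hs.1.le)
    ((hcont ψ).intervalIntegrable _ _)]
  have h0 : P 0 φ = φ := hP.map_zero φ
  simp [h0]

end Orbits

/-! ### Transition measures solve the Fokker–Planck–Kolmogorov equation -/

section Solutions

variable [MeasurableSpace E] [BorelSpace E] [T35Space E]
  {hκ : BddAbove (range fun x => (κ x : ℝ))} {P : ℝ≥0 → CKappa κ →ₗ[ℝ] CKappa κ}

/-- The measures `P_t(x, ·)` representing `φ ↦ P_t φ(x)` form a narrowly continuous curve. -/
theorem IsMarkovC0Semigroup.exists_transition (hP : IsMarkovC0Semigroup hκ P) (x : E) :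
    ∃ ν : C(ℝ≥0, KappaMeasure κ),
      ∀ (t : ℝ≥0) (φ : CKappa κ), ∫ y, φ y ∂(ν t).toMeasure = P t φ x := by
  have h : ∀ t, ∃ μ : KappaMeasure κ, ∀ φ : CKappa κ, ∫ y, φ y ∂μ.toMeasure = P t φ x := by
    intro t
    let Λ : CKappa κ →ₗ[ℝ] ℝ :=
      { toFun := fun φ => P t φ x
        map_add' := fun φ ψ => by rw [map_add, CKappa.add_apply]
        map_smul' := fun c φ => by rw [map_smul, CKappa.smul_apply]; rfl }
    exact exists_kappaMeasure_integral_eq (Λ := Λ)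
      ((continuous_eval x).comp (hP.isC0Semigroup.continuous t))
      fun φ hφ => hP.nonneg t φ hφ x
  choose ν hν using h
  refine ⟨⟨ν, ?_⟩, hν⟩
  refine continuous_iInf_rng.mpr fun φ => continuous_induced_rng.mpr ?_
  refine ((continuous_eval x).comp (hP.isC0Semigroup.continuous_orbit φ)).congr fun t => ?_
  exact (hν t φ).symm

/-- The integrability of `1 / κ` holds because `1 / κ` itself belongs to `C_κ(E)`, so that its
integral is the continuous function `t ↦ P_t (1 / κ)(x)`. -/
theorem IsMarkovC0Semigroup.isFPKSolution_transition (hP : IsMarkovC0Semigroup hκ P)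
    {L₀ : CKappa κ →ₗ.[ℝ] CKappa κ} (hle : L₀ ≤ generator P) {x : E}
    {ν : C(ℝ≥0, KappaMeasure κ)}
    (hν : ∀ (t : ℝ≥0) (φ : CKappa κ), ∫ y, φ y ∂(ν t).toMeasure = P t φ x) :
    IsFPKSolution L₀ x ν where
  equation t φ := by
    have hgen : HasGeneratorAt P (φ : CKappa κ) (L₀ φ) :=
      (mem_graph_generator P _ _).mp (LinearPMap.le_graph_of_le hle (L₀.mem_graph φ))
    simp only [hν]
    rw [integral_dirac, hgen.integral_orbit hP.isC0Semigroup x t, add_sub_cancel]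
  mass t := by
    have hint := (ν t).integrable (one hκ)
    have h := hν t (one hκ)
    rw [hP.map_one] at h
    have hfin : (ν t).toMeasure univ ≠ ⊤ := by
      have := ((integrable_const_iff (c := (1 : ℝ))).mp hint).resolve_left one_ne_zero
      exact measure_ne_top _ _
    have h' : (ν t).toMeasure.real univ = 1 := by simpa using h
    rw [← ENNReal.ofReal_toReal hfin]
    exact (congrArg ENNReal.ofReal h').trans ENNReal.ofReal_one
  integrability T _ := by
    have hpt : ∀ s : ℝ,
        ∫⁻ y, ENNReal.ofReal (1 / (κ y : ℝ)) ∂(ν s.toNNReal).toMeasure =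
          ENNReal.ofReal (P s.toNNReal (invWeight κ) x) := by
      intro s
      rw [← hν, ofReal_integral_eq_lintegral_ofReal ((ν _).integrable _)
        (ae_of_all _ fun y => (one_div_pos.mpr (κ y).2).le)]
      rfl
    simp only [hpt]
    have hcont : Continuous fun s : ℝ => P s.toNNReal (invWeight κ) x :=
      (continuous_eval x).comp
        ((hP.isC0Semigroup.continuous_orbit _).comp continuous_real_toNNReal)
    exact (hcont.integrableOn_Ioc (a := 0) (b := T)).lintegral_lt_top

/-- Two Markov `C₀`-semigroups whose generators extend `L₀` agree as soon as the
Fokker–Planck–Kolmogorov equation for `L₀` has at most one solution for each initial point. -/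
theorem IsMarkovC0Semigroup.eq_of_unique_isFPKSolution (hP : IsMarkovC0Semigroup hκ P)
    {Q : ℝ≥0 → CKappa κ →ₗ[ℝ] CKappa κ} (hQ : IsMarkovC0Semigroup hκ Q)
    {L₀ : CKappa κ →ₗ.[ℝ] CKappa κ} (hleP : L₀ ≤ generator P) (hleQ : L₀ ≤ generator Q)
    (huniq : ∀ (x : E) (ν ν' : C(ℝ≥0, KappaMeasure κ)),
      IsFPKSolution L₀ x ν → IsFPKSolution L₀ x ν' → ν = ν') : P = Q := by
  funext t
  refine LinearMap.ext fun φ => CKappa.ext fun x => ?_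
  obtain ⟨ν, hν⟩ := hP.exists_transition x
  obtain ⟨ν', hν'⟩ := hQ.exists_transition x
  rw [← hν t φ, ← hν' t φ, huniq x ν ν' (hP.isFPKSolution_transition hleP hν)
    (hQ.isFPKSolution_transition hleQ hν')]

end Solutions

end MixedTopology

end

theorem mainTheorem4 {E : Type*} [TopologicalSpace E] [T35Space E] [MeasurableSpace E]
    [BorelSpace E] (hE : MixedTopology.SpaceHypothesis E)
    (κ : C(E, Set.Ioi (0 : ℝ))) (hκ : BddAbove (Set.range fun x => (κ x : ℝ)))
    (P : ℝ≥0 → MixedTopology.CKappa κ →ₗ[ℝ] MixedTopology.CKappa κ)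
    (hP : MixedTopology.IsMarkovC0Semigroup hκ P)
    (L₀ : MixedTopology.CKappa κ →ₗ.[ℝ] MixedTopology.CKappa κ)
    (hdense : Dense (L₀.domain : Set (MixedTopology.CKappa κ)))
    (hle : L₀ ≤ MixedTopology.generator P)
    (hFPK : ∀ x : E, ∃! ν : C(ℝ≥0, MixedTopology.KappaMeasure κ),
      MixedTopology.IsFPKSolution L₀ x ν) :
    MixedTopology.IsMarkovCoreOperator hκ L₀ (MixedTopology.generator P) where
  dense := hdense
  le := hle
  isGenerator := ⟨P, hP, rfl⟩
  unique Q hQ hleQ := by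
    rw [hP.eq_of_unique_isFPKSolution hQ hle hleQ fun x _ _ h h' => (hFPK x).unique h h']
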